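/- Let $n\ge 1$, and let $T=\{(i,j): 1\le i<j\le n\}$. A vector $v=(v_{ij})_{(i,j)\in T}\in\mathbb N^T$ (with $0\in\mathbb N$) is called admitted if $v_{i,i+1}=0$ for $1\le i<n$ and $v_{ij}+v_{jk}\le v_{ik}\le v_{ij}+v_{jk}+1$ for all $1\le i<j<k\le n$; the set of admitted vectors is ordered componentwise. Let $\tilde S_n$ be the affine symmetric group: the group, under composition, of the permutations $f$ of $\mathbb Z$ such that $f(x+n)=f(x)+n$ for all $x\in\mathbb Z$ and $f(1)+\cdots+f(n)=n(n+1)/2$. Such an $f$ is identified with its window $[f(1),\dots,f(n)]$. For $n\ge2$ and $k=0,\dots,n-1$, let $s_k\in\tilde S_n$ be the element that sends $x$ to $x+1$ if $x\equiv k\pmod n$, sends $x$ to $x-1$ if $x\equiv k+1\pmod n$, and fixes every other integer $x$ (for $n=1$ the group is trivial, and the set of generators is taken to be empty). The Coxeter length $\ell(f)$ is the least $m$ such that $f$ is a product of $m$ of the elements $s_0,\dots,s_{n-1}$. The left weak order on $\tilde S_n$ is the reflexive and transitive closure of the relation: $g=s_kf$ for some $k$, and $\ell(g)=\ell(f)+1$.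 **Theorem.** There is an element $f_c\in\tilde S_n$ with window $[c_1,\dots,c_n]$, where $c_1=-n(n-3)/2$ and $c_{i+1}=c_i+n-1$ for $1\le i<n$. The map $v\mapsto F(v)=[a_1,\dots,a_n]$ defined by $$a_i=i+\sum_{p<i}v_{pi}-\sum_{i<p}v_{ip}\qquad(1\le i\le n)$$ sends each admitted vector to the window of an element of $\tilde S_n$, and it is an isomorphism of posets from the set of admitted vectors onto the interval $[\mathrm{id},f_c]$ of $\tilde S_n$ with the left weak order. Moreover, $v\mapsto\ell(F(v))$ is the rank function of the poset of admitted vectors: it is $0$ on the minimal elements, and $\ell(F(v'))=\ell(F(v))+1$ whenever $v'$ covers $v$. This rank function is $\ell(F(v))=\sum_{1\le i<j\le n}v_{ij}$. -/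

import Mathlib

open Finset

/-- The index set `{(i, j) : 1 ≤ i < j ≤ n}`; the element `i : Fin n` stands for the
integer `i + 1` of `{1, …, n}`. -/
abbrev PairIndex (n : ℕ) : Type := {p : Fin n × Fin n // p.1 < p.2}

/-- The coordinate `v_{ij}` of `v ∈ ℕ^T`, where `i < j`. -/
def coord {n : ℕ} (v : PairIndex n → ℕ) (i j : Fin n) (h : i < j) : ℕ := v ⟨(i, j), h⟩

/-- Admitted vectors: `v_{i,i+1} = 0` and `v_{ij} + v_{jk} ≤ v_{ik} ≤ v_{ij} + v_{jk} + 1`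
for `i < j < k`. -/
def IsAdmitted {n : ℕ} (v : PairIndex n → ℕ) : Prop :=
  (∀ (i j : Fin n) (h : i < j), (j : ℕ) = (i : ℕ) + 1 → coord v i j h = 0) ∧
  (∀ (i j k : Fin n) (hij : i < j) (hjk : j < k),
    coord v i j hij + coord v j k hjk ≤ coord v i k (hij.trans hjk) ∧
    coord v i k (hij.trans hjk) ≤ coord v i j hij + coord v j k hjk + 1)

/-- The poset of admitted vectors, with the componentwise order inherited from `ℕ^T`. -/
abbrev AdmittedVector (n : ℕ) : Type := {v : PairIndex n → ℕ // IsAdmitted v}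

/-- The map `F(v)_i = i + ∑_{p<i} v_{pi} - ∑_{i<p} v_{ip}`, with values in `ℤ^n`. -/
def windowMap {n : ℕ} (v : PairIndex n → ℕ) : Fin n → ℤ := fun i =>
  ((i : ℤ) + 1) + ∑ p : {p : Fin n // p < i}, (coord v p.1 i p.2 : ℤ)
    - ∑ p : {p : Fin n // i < p}, (coord v i p.1 p.2 : ℤ)

theorem periodic_add_mul {n : ℕ} {f : Equiv.Perm ℤ} (hf : ∀ x, f (x + n) = f x + n)
    (x k : ℤ) : f (x + k * n) = f x + k * n := by
  induction k using Int.induction_on with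
  | zero => simp
  | succ k ih =>
    have : x + ((k : ℤ) + 1) * n = (x + k * n) + n := by ring
    rw [this, hf, ih]; ring
  | pred k ih =>
    have h := hf (x + (-(k : ℤ) - 1) * n)
    have e : x + (-(k : ℤ) - 1) * n + n = x + -(k : ℤ) * n := by ring
    rw [e, ih] at h
    linarith

theorem periodic_symm {n : ℕ} {f : Equiv.Perm ℤ} (hf : ∀ x, f (x + n) = f x + n)
    (x : ℤ) : f.symm (x + n) = f.symm x + n := by
  apply f.injective
  rw [hf]; simp

theorem sum_comp_periodic {n : ℕ} {g : Equiv.Perm ℤ} (hg : ∀ x, g (x + n) = g x + n)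
    (d : ℤ → ℤ) (hd : ∀ x k : ℤ, d (x + k * n) = d x) :
    ∑ x ∈ Icc (1 : ℤ) n, d (g x) = ∑ x ∈ Icc (1 : ℤ) n, d x := by
  rcases Nat.eq_zero_or_pos n with rfl | hn
  · simp
  have hn' : (0 : ℤ) < n := by exact_mod_cast hn
  set r : ℤ → ℤ := fun x => (g x - 1) % n + 1 with hr
  have hmaps : Set.MapsTo r (Icc (1 : ℤ) n : Finset ℤ) (Icc (1 : ℤ) n : Finset ℤ) := by
    intro x _
    have h1 := Int.emod_nonneg (g x - 1) hn'.ne'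
    have h2 := Int.emod_lt_of_pos (g x - 1) hn'
    simp only [coe_Icc, Set.mem_Icc, hr]
    constructor <;> linarith
  have hinj : Set.InjOn r (Icc (1 : ℤ) n : Finset ℤ) := by
    intro x hx y hy hxy
    simp only [coe_Icc, Set.mem_Icc] at hx hy
    have h : (g x - 1) % n = (g y - 1) % n := by simpa [hr] using hxy
    obtain ⟨k, hk⟩ := Int.ModEq.dvd (show (g y - 1) ≡ (g x - 1) [ZMOD n] from h.symm)
    have hgx : g x = g (y + k * n) := by rw [periodic_add_mul hg]; linarith
    have hxk := g.injective hgx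
    have : k = 0 := by
      by_contra hk0
      rcases lt_or_gt_of_ne hk0 with h0 | h0
      · nlinarith
      · nlinarith
    simpa [this] using hxk
  refine Finset.sum_nbij r hmaps hinj
    (Finset.surjOn_of_injOn_of_card_le r hmaps hinj le_rfl) ?_
  intro x _
  have h := Int.emod_add_mul_ediv (g x - 1) n
  have : g x = r x + ((g x - 1) / n) * n := by
    simp only [hr]; linarith
  rw [this, hd]

theorem mul_sum_eq {n : ℕ} {f g : Equiv.Perm ℤ} (hf : ∀ x, f (x + n) = f x + n)
    (hg : ∀ x, g (x + n) = g x + n) :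
    ∑ x ∈ Icc (1 : ℤ) n, (f * g) x =
      ∑ x ∈ Icc (1 : ℤ) n, f x + ∑ x ∈ Icc (1 : ℤ) n, g x - ∑ x ∈ Icc (1 : ℤ) n, x := by
  have h := sum_comp_periodic hg (fun x => f x - x) (by
    intro x k
    simp only [periodic_add_mul hf]; ring)
  simp only [sum_sub_distrib] at h
  simp only [Equiv.Perm.mul_apply]
  linarith

theorem sum_Icc_id (n : ℕ) : ∑ x ∈ Icc (1 : ℤ) n, x = (n : ℤ) * (n + 1) / 2 := by
  have h : ∀ m : ℕ, 2 * ∑ x ∈ Icc (1 : ℤ) m, x = (m : ℤ) * (m + 1) := by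
    intro m
    induction m with
    | zero => simp
    | succ m ih =>
      have e : Icc (1 : ℤ) ((m + 1 : ℕ) : ℤ) = insert ((m : ℤ) + 1) (Icc (1 : ℤ) m) := by
        ext x; simp only [mem_Icc, mem_insert]; push_cast; omega
      rw [e, sum_insert (by simp), mul_add, ih]; push_cast; ring
  have := h n
  omega

/-- The affine symmetric group `S̃_n`: the permutations `f` of `ℤ` with `f(x + n) = f(x) + n`
for all `x` and `f(1) + ⋯ + f(n) = n(n+1)/2`, under composition. -/
def affineSymmetricGroup (n : ℕ) : Subgroup (Equiv.Perm ℤ) where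
  carrier := {f | (∀ x, f (x + n) = f x + n) ∧
    ∑ x ∈ Icc (1 : ℤ) n, f x = (n : ℤ) * (n + 1) / 2}
  one_mem' := ⟨fun x => by simp, by simpa using sum_Icc_id n⟩
  mul_mem' := by
    rintro f g ⟨hf, hf'⟩ ⟨hg, hg'⟩
    refine ⟨fun x => by simp [hf, hg], ?_⟩
    rw [mul_sum_eq hf hg, hf', hg', sum_Icc_id]; ring
  inv_mem' := by
    rintro f ⟨hf, hf'⟩
    have hi : ∀ x, f⁻¹ (x + n) = f⁻¹ x + n := periodic_symm hf
    refine ⟨hi, ?_⟩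
    have h := mul_sum_eq hf hi
    rw [mul_inv_cancel, hf'] at h
    simp only [Equiv.Perm.one_apply] at h
    rw [sum_Icc_id] at h
    linarith

/-- The window `[f(1), …, f(n)]` of an affine permutation `f`. -/
def window {n : ℕ} (f : affineSymmetricGroup n) : Fin n → ℤ := fun i => f.1 ((i : ℤ) + 1)

/-- The function exchanging `k + mn` and `k + 1 + mn` for every integer `m`. -/
def adjSwapFun (n : ℕ) (k x : ℤ) : ℤ :=
  if (n : ℤ) ∣ x - k then x + 1 else if (n : ℤ) ∣ x - (k + 1) then x - 1 else x

theorem not_dvd_one_of_two_le {n : ℕ} (hn : 2 ≤ n) : ¬ (n : ℤ) ∣ 1 := by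
  intro h
  have := Int.le_of_dvd one_pos h
  omega

theorem adjSwapFun_involutive {n : ℕ} (hn : 2 ≤ n) (k : ℤ) :
    Function.Involutive (adjSwapFun n k) := by
  intro x
  have h1 := not_dvd_one_of_two_le hn
  unfold adjSwapFun
  by_cases ha : (n : ℤ) ∣ x - k
  · have hb : ¬ (n : ℤ) ∣ x + 1 - k := fun h => h1 (by
      have := dvd_sub h ha; ring_nf at this; simpa using this)
    simp [ha, hb]
  · by_cases hb : (n : ℤ) ∣ x - (k + 1)
    · have hc : (n : ℤ) ∣ x - 1 - k := by
        have e : x - 1 - k = x - (k + 1) := by ring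
        rw [e]; exact hb
      simp [ha, hb, hc]
    · simp [ha, hb]

theorem adjSwapFun_add (n : ℕ) (k x : ℤ) :
    adjSwapFun n k (x + n) = adjSwapFun n k x + n := by
  have e1 : (n : ℤ) ∣ x + n - k ↔ (n : ℤ) ∣ x - k := by
    rw [show x + n - k = (x - k) + n by ring]; exact dvd_add_self_right
  have e2 : (n : ℤ) ∣ x + n - (k + 1) ↔ (n : ℤ) ∣ x - (k + 1) := by
    rw [show x + n - (k + 1) = (x - (k + 1)) + n by ring]; exact dvd_add_self_right
  unfold adjSwapFun
  simp only [e1, e2]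
  split_ifs <;> ring

theorem sum_adjSwapFun {n : ℕ} (hn : 2 ≤ n) (k : ℤ) :
    ∑ x ∈ Icc (1 : ℤ) n, adjSwapFun n k x = (n : ℤ) * (n + 1) / 2 := by
  have h1 := not_dvd_one_of_two_le hn
  set e : ℤ → ℤ := fun x => if (n : ℤ) ∣ x - k then 1 else 0 with he
  have key : ∀ x, adjSwapFun n k x = x + e x - e (Equiv.addRight (-1 : ℤ) x) := by
    intro x
    have h3 : x + -1 - k = x - (k + 1) := by ring
    simp only [he, adjSwapFun, Equiv.coe_addRight, h3]
    by_cases ha : (n : ℤ) ∣ x - k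
    · have hb : ¬ (n : ℤ) ∣ x - (k + 1) := fun h => h1 (by
        have := dvd_sub ha h; ring_nf at this; simpa using this)
      simp [ha, hb]
    · by_cases hb : (n : ℤ) ∣ x - (k + 1) <;> simp [ha, hb]
  have hs := sum_comp_periodic (n := n) (g := Equiv.addRight (-1 : ℤ))
    (fun x => by simp; ring) e (fun x m => by
      have : (n : ℤ) ∣ x + m * n - k ↔ (n : ℤ) ∣ x - k := by
        rw [show x + m * n - k = (x - k) + m * n by ring]
        exact (dvd_add_left (Dvd.intro_left m rfl))
      simp only [he, this])
  simp only [key, sum_sub_distrib, sum_add_distrib, hs, sum_Icc_id]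
  ring

/-- The adjacent affine transposition `s_k`, for `k = 0, …, n - 1`: it exchanges `k` and `k + 1`
(and their translates by multiples of `n`). For `n ≤ 1` there is no such element, and the value
is the identity. -/
def adjSwap {n : ℕ} (k : Fin n) : affineSymmetricGroup n :=
  if hn : 2 ≤ n then
    ⟨(adjSwapFun_involutive hn (k : ℤ)).toPerm,
      fun x => adjSwapFun_add n k x, sum_adjSwapFun hn k⟩
  else 1

/-- The Coxeter length: the least length of a word in `s_0, …, s_{n-1}` with product `f`. -/
noncomputable def coxeterLength {n : ℕ} (f : affineSymmetricGroup n) : ℕ :=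
  sInf {m | ∃ w : List (Fin n), w.length = m ∧ (w.map adjSwap).prod = f}

/-- The covering relation of the left weak order. -/
def LeftWeakCovers {n : ℕ} (f g : affineSymmetricGroup n) : Prop :=
  (∃ k : Fin n, g = adjSwap k * f) ∧ coxeterLength g = coxeterLength f + 1

theorem length_le_of_reflTransGen {n : ℕ} {f g : affineSymmetricGroup n}
    (h : Relation.ReflTransGen LeftWeakCovers f g) :
    f = g ∨ coxeterLength f < coxeterLength g := by
  induction h with
  | refl => exact Or.inl rfl
  | tail _ hc ih =>
    right
    rcases ih with rfl | ih
    · rw [hc.2]; exact Nat.lt_succ_self _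
    · rw [hc.2]; exact ih.trans (Nat.lt_succ_self _)

/-- The left weak order on `S̃_n`: the reflexive and transitive closure of its covering
relation. -/
instance leftWeakOrder (n : ℕ) : PartialOrder (affineSymmetricGroup n) where
  le f g := Relation.ReflTransGen LeftWeakCovers f g
  le_refl _ := Relation.ReflTransGen.refl
  le_trans _ _ _ h h' := h.trans h'
  le_antisymm f g h h' := by
    rcases length_le_of_reflTransGen h with e | e
    · exact e
    · rcases length_le_of_reflTransGen h' with e' | e'
      · exact e'.symm
      · exact absurd e (not_lt.mpr e'.le)

/-- The sequence `c_1 = -n(n-3)/2`, `c_{i+1} = c_i + n - 1`, with indices shifted by one: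
`cSeq n i` is `c_{i+1}`. -/
def cSeq (n : ℕ) : ℕ → ℤ
  | 0 => -((n : ℤ) * ((n : ℤ) - 3) / 2)
  | i + 1 => cSeq n i + (n : ℤ) - 1

/-- `ρ` is the rank function of a (graded) poset: it vanishes on the minimal elements and
increases by one along every covering relation. -/
def IsRankFunction {P : Type*} [PartialOrder P] (ρ : P → ℕ) : Prop :=
  (∀ x, IsMin x → ρ x = 0) ∧ ∀ x y, x ⋖ y → ρ y = ρ x + 1

/-! Encode `f` by its Shi coordinates `⌊(f(q) - f(p)) / n⌋` for positions `p < q`. Left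
multiplication by a generator exchanges two adjacent residue classes of values, so it changes
exactly one coordinate, by ±1.

The engine is `exists_adjSwap_mul_le`: if `f ≠ g` and `f` lies below `g` coordinatewise, a descent
of `g * f⁻¹` names a generator that raises one coordinate of `f` and stays below `g`. Hence
coordinates determine `f`. On elements with nonnegative coordinates the length is the coordinate
sum: climbing from the identity gives a word of that length, and each letter adds at most one to the
sum of absolute values. There, among elements above the identity, the weak order is the
componentwise order (`le_of_shiVector_le`, `shiVector_le_of_le`).

The coordinates of `f_c` are `q - p - 1`, the largest values that admitted vectors allow. Floors
always satisfy the two triangle inequalities, so the coordinates of an element of `[id, f_c]` are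
admitted. Conversely, `windowMap` inverts the encoding, by `windowMap_sub_bounds`. -/

/-! ### Floors and residues modulo `n`. -/

theorem add_one_ediv_of_not_dvd {n a : ℤ} (hn : 0 < n) (h : ¬ n ∣ a + 1) :
    (a + 1) / n = a / n := by
  have h1 := Int.emod_add_mul_ediv a n
  have h2 := Int.emod_nonneg a hn.ne'
  have h3 := Int.emod_lt_of_pos a hn
  rw [Int.ediv_eq_iff_of_pos hn]
  have h4 : a % n + 1 ≠ n := fun e => h ⟨a / n + 1, by linarith⟩
  have h5 : a % n + 1 < n := lt_of_le_of_ne h3 h4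
  constructor <;> linarith

theorem mul_add_ediv_of_lt {n a m r : ℤ} (h0 : 0 ≤ r) (h1 : r < n) (h : a = m * n + r) :
    a / n = m := by
  rw [Int.ediv_eq_iff_of_pos (h0.trans_lt h1)]
  constructor <;> linarith

/-- Every integer is a translate of an element of `{1, …, n}` by a multiple of `n`. -/
theorem exists_window_index {n : ℕ} (hn : 1 ≤ n) (x : ℤ) :
    ∃ (i : Fin n) (m : ℤ), x = (i : ℤ) + 1 + m * n := by
  have hn' : (0 : ℤ) < n := by exact_mod_cast hn
  have h0 := Int.emod_nonneg (x - 1) hn'.ne'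
  have h1 := Int.emod_lt_of_pos (x - 1) hn'
  have h2 := Int.emod_add_mul_ediv (x - 1) n
  refine ⟨⟨((x - 1) % n).toNat, by omega⟩, (x - 1) / n, ?_⟩
  simp only [Int.toNat_of_nonneg h0]
  linarith

theorem eq_of_dvd_sub {n : ℕ} {i j : Fin n} (h : (n : ℤ) ∣ (i : ℤ) - j) : i = j := by
  have h1 := i.isLt
  have h2 := j.isLt
  have := Int.eq_zero_of_abs_lt_dvd h (by rw [abs_lt]; omega)
  exact Fin.ext (by omega)

theorem apply_index {n : ℕ} (f : affineSymmetricGroup n) (i : Fin n) (m : ℤ) :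
    f.1 ((i : ℤ) + 1 + m * n) = window f i + m * n :=
  periodic_add_mul f.2.1 _ _

theorem window_injective_mod {n : ℕ} (f : affineSymmetricGroup n) {p q : Fin n}
    (h : (n : ℤ) ∣ window f p - window f q) : p = q := by
  obtain ⟨m, hm⟩ := h
  have h1 : f.1 ((p : ℤ) + 1) = f.1 ((q : ℤ) + 1 + m * n) := by
    rw [apply_index]
    have : window f p = f.1 ((p : ℤ) + 1) := rfl
    linarith
  have h2 := f.1.injective h1
  exact eq_of_dvd_sub ⟨m, by linarith⟩

/-! ### Shi coordinates and the action of the generators. -/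

/-- The coordinate `⌊(f(q) - f(p)) / n⌋` of an affine permutation. -/
def shiCoord {n : ℕ} (f : affineSymmetricGroup n) (p q : Fin n) : ℤ :=
  (window f q - window f p) / n

/-- An affine permutation other than the identity has a descent. -/
theorem exists_descent {n : ℕ} (hn : 1 ≤ n) {h : affineSymmetricGroup n} (hh : h ≠ 1) :
    ∃ k : ℤ, h.1 (k + 1) < h.1 k := by
  by_contra! hc
  have hlt : ∀ k : ℤ, h.1 k < h.1 (k + 1) := fun k =>
    lt_of_le_of_ne (hc k) fun e => by
      have := h.1.injective e
      omega
  have hmono : StrictMono h.1 := strictMono_int_of_lt_succ hlt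
  have hstep : ∀ k : ℤ, h.1 (k + 1) = h.1 k + 1 := by
    -- The preimage of `h k + 1` lies to the right of `k`; monotonicity leaves only `k + 1`. So `h`
    -- is a translation, and the normalised window sum makes it trivial.
    intro k
    obtain ⟨x, hx⟩ := h.1.surjective (h.1 k + 1)
    have h1 : k < x := hmono.lt_iff_lt.1 (by omega)
    have h2 := hmono.monotone (show k + 1 ≤ x by omega)
    have := hlt k
    omega
  have hall : ∀ x : ℤ, h.1 x = x + h.1 0 := by
    intro x
    induction x using Int.induction_on with
    | zero => simp
    | succ k ih => rw [hstep, ih]; ring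
    | pred k ih =>
      have := hstep (-(k : ℤ) - 1)
      rw [sub_add_cancel, ih] at this
      linarith
  have hs := h.2.2
  rw [sum_congr rfl fun x _ => hall x, sum_add_distrib, sum_Icc_id, sum_const, Int.card_Icc] at hs
  have h0 : h.1 0 = 0 := by
    have : (n : ℤ) * h.1 0 = 0 := by simpa using hs
    rcases mul_eq_zero.1 this with e | e
    · omega
    · exact e
  apply hh
  apply Subtype.ext
  ext x
  rw [hall, h0]
  simp

theorem adjSwap_apply {n : ℕ} (hn : 2 ≤ n) (k : Fin n) (x : ℤ) :
    (adjSwap k).1 x = adjSwapFun n k x := by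
  simp [adjSwap, hn]

theorem window_adjSwap_mul {n : ℕ} (hn : 2 ≤ n) (f : affineSymmetricGroup n) (k i j : Fin n)
    {a b : ℤ} (hi : window f i = k - a * n) (hj : window f j = k + 1 - b * n) (p : Fin n) :
    window (adjSwap k * f) p =
      if p = i then window f p + 1 else if p = j then window f p - 1 else window f p := by
  have hw : window (adjSwap k * f) p = adjSwapFun n k (window f p) := by
    rw [← adjSwap_apply hn]; rfl
  have e1 : (n : ℤ) ∣ window f p - k ↔ p = i := by
    constructor
    · intro h
      apply window_injective_mod f
      have := dvd_add h (Dvd.intro_left a rfl : (n : ℤ) ∣ a * n)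
      rwa [show window f p - k + a * n = window f p - window f i by rw [hi]; ring] at this
    · rintro rfl
      exact ⟨-a, by rw [hi]; ring⟩
  have e2 : (n : ℤ) ∣ window f p - (k + 1) ↔ p = j := by
    constructor
    · intro h
      apply window_injective_mod f
      have := dvd_add h (Dvd.intro_left b rfl : (n : ℤ) ∣ b * n)
      rwa [show window f p - (k + 1) + b * n = window f p - window f j by rw [hj]; ring] at this
    · rintro rfl
      exact ⟨-b, by rw [hj]; ring⟩
  rw [hw, adjSwapFun]
  simp only [e1, e2]

/-- Left multiplication by `s_k` changes the coordinates only at the pair of positions whose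
values are congruent to `k` and `k + 1`. -/
theorem shiCoord_adjSwap_mul {n : ℕ} (hn : 2 ≤ n) (f : affineSymmetricGroup n) (k i j : Fin n)
    {a b : ℤ} (hi : window f i = k - a * n) (hj : window f j = k + 1 - b * n) (p q : Fin n) :
    shiCoord (adjSwap k * f) p q = shiCoord f p q + (if p = j ∧ q = i then 1 else 0)
      - (if p = i ∧ q = j then 1 else 0) := by
  have hn' : (0 : ℤ) < n := by omega
  have hn2 : (2 : ℤ) ≤ n := by omega
  have hij : i ≠ j := by
    rintro rfl
    exact not_dvd_one_of_two_le hn ⟨b - a, by linarith⟩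
  have hji := hij.symm
  -- A unit change in a difference moves its floor only across a multiple of `n`. That would make
  -- the value at `p` congruent to the one at `i` or `j`, forcing `p` to be that position.
  have up : ∀ p, p ≠ i → p ≠ j →
      (window f i + 1 - window f p) / n = (window f i - window f p) / n := by
    intro p h1 h2
    rw [show window f i + 1 - window f p = (window f i - window f p) + 1 by ring]
    apply add_one_ediv_of_not_dvd hn'
    intro h
    apply h2.symm
    apply window_injective_mod f
    have := dvd_add h (Dvd.intro_left (a - b) rfl : (n : ℤ) ∣ (a - b) * n)
    rwa [show window f i - window f p + 1 + (a - b) * n = window f j - window f p by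
      rw [hi, hj]; ring] at this
  have dn : ∀ p, p ≠ i → p ≠ j →
      (window f j - 1 - window f p) / n = (window f j - window f p) / n := by
    intro p h1 h2
    symm
    rw [show window f j - window f p = (window f j - 1 - window f p) + 1 by ring]
    apply add_one_ediv_of_not_dvd hn'
    intro h
    apply h2.symm
    apply window_injective_mod f
    rwa [show window f j - 1 - window f p + 1 = window f j - window f p by ring] at h
  have up' : ∀ p, p ≠ i → p ≠ j →
      (window f p - (window f j - 1)) / n = (window f p - window f j) / n := by
    intro p h1 h2
    rw [show window f p - (window f j - 1) = (window f p - window f j) + 1 by ring]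
    apply add_one_ediv_of_not_dvd hn'
    intro h
    apply h1
    apply window_injective_mod f
    have := dvd_add h (Dvd.intro_left (a - b) rfl : (n : ℤ) ∣ (a - b) * n)
    rwa [show window f p - window f j + 1 + (a - b) * n = window f p - window f i by
      rw [hi, hj]; ring] at this
  have dn' : ∀ p, p ≠ i → p ≠ j →
      (window f p - (window f i + 1)) / n = (window f p - window f i) / n := by
    intro p h1 h2
    symm
    rw [show window f p - window f i = (window f p - (window f i + 1)) + 1 by ring]
    apply add_one_ediv_of_not_dvd hn'
    intro h
    apply h1
    apply window_injective_mod f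
    rwa [show window f p - (window f i + 1) + 1 = window f p - window f i by ring] at h
  unfold shiCoord
  rw [window_adjSwap_mul hn f k i j hi hj p, window_adjSwap_mul hn f k i j hi hj q]
  by_cases hpi : p = i
  · subst hpi
    by_cases hqi : q = p
    · subst hqi; simp
    · by_cases hqj : q = j
      · subst hqj
        simp only [hij, hji, if_true, if_false, and_true, and_false, hi, hj]
        -- The difference is 1 modulo `n` before the exchange and -1 after it, whence the remainders
        -- `1` and `n - 1`.
        rw [mul_add_ediv_of_lt (n := n) (m := a - b - 1) (r := n - 1) (by omega) (by omega) (by ring),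
          mul_add_ediv_of_lt (n := n) (m := a - b) (r := 1) (by omega) (by omega) (by ring)]
        ring
      · simp [hqi, hqj, dn' q hqi hqj]
  · by_cases hpj : p = j
    · subst hpj
      by_cases hqi : q = i
      · subst hqi
        simp only [hij, hji, if_true, if_false, and_true, and_false, hi, hj]
        rw [mul_add_ediv_of_lt (n := n) (m := b - a) (r := 1) (by omega) (by omega) (by ring),
          mul_add_ediv_of_lt (n := n) (m := b - a - 1) (r := n - 1) (by omega) (by omega) (by ring)]
        ring
      · by_cases hqj : q = p
        · subst hqj; simp
        · simp [hpi, hqi, hqj, up' q hqi hqj]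
    · by_cases hqi : q = i
      · subst hqi; simp [hpi, hpj, up p hpi hpj]
      · by_cases hqj : q = j
        · subst hqj; simp [hpi, hpj, hqi, dn p hpi hpj]
        · simp [hpi, hpj, hqi, hqj]

/-- The coordinates at the pairs `(p, q)` with `p < q`. -/
def shiVector {n : ℕ} (f : affineSymmetricGroup n) (t : PairIndex n) : ℤ :=
  shiCoord f t.1.1 t.1.2

theorem shiVector_adjSwap_mul_of_gt {n : ℕ} (hn : 2 ≤ n) (f : affineSymmetricGroup n)
    (k : Fin n) {i j : Fin n} {a b : ℤ} (hi : window f i = k - a * n)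
    (hj : window f j = k + 1 - b * n) (h : j < i) (t : PairIndex n) :
    shiVector (adjSwap k * f) t = shiVector f t + if t = ⟨(j, i), h⟩ then 1 else 0 := by
  obtain ⟨⟨p, q⟩, hpq⟩ := t
  have hpq' : p < q := hpq
  have hno : ¬ (p = i ∧ q = j) := by
    rintro ⟨rfl, rfl⟩
    exact absurd h hpq'.not_gt
  simp only [shiVector, shiCoord_adjSwap_mul hn f k i j hi hj, hno, if_false, Subtype.mk.injEq,
    Prod.mk.injEq, sub_zero]

theorem shiVector_adjSwap_mul_of_lt {n : ℕ} (hn : 2 ≤ n) (f : affineSymmetricGroup n)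
    (k : Fin n) {i j : Fin n} {a b : ℤ} (hi : window f i = k - a * n)
    (hj : window f j = k + 1 - b * n) (h : i < j) (t : PairIndex n) :
    shiVector (adjSwap k * f) t = shiVector f t - if t = ⟨(i, j), h⟩ then 1 else 0 := by
  obtain ⟨⟨p, q⟩, hpq⟩ := t
  have hpq' : p < q := hpq
  have hno : ¬ (p = j ∧ q = i) := by
    rintro ⟨rfl, rfl⟩
    exact absurd h hpq'.not_gt
  simp only [shiVector, shiCoord_adjSwap_mul hn f k i j hi hj, hno, if_false, Subtype.mk.injEq,
    Prod.mk.injEq, add_zero]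

theorem exists_window_eq {n : ℕ} (hn : 1 ≤ n) (f : affineSymmetricGroup n) (y : ℤ) :
    ∃ (i : Fin n) (a : ℤ), window f i = y - a * n ∧ f.1.symm y = (i : ℤ) + 1 + a * n := by
  obtain ⟨i, a, h⟩ := exists_window_index hn (f.1.symm y)
  refine ⟨i, a, ?_, h⟩
  have := congrArg f.1 h
  rw [Equiv.apply_symm_apply, apply_index] at this
  linarith

theorem exists_shiVector_adjSwap_mul {n : ℕ} (hn : 2 ≤ n) (f : affineSymmetricGroup n)
    (k : Fin n) : ∃ (t₀ : PairIndex n) (ε : ℤ), |ε| = 1 ∧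
      ∀ t, shiVector (adjSwap k * f) t = shiVector f t + if t = t₀ then ε else 0 := by
  obtain ⟨i, a, hi, -⟩ := exists_window_eq (by omega) f (k : ℤ)
  obtain ⟨j, b, hj, -⟩ := exists_window_eq (by omega) f ((k : ℤ) + 1)
  rcases lt_trichotomy i j with h | h | h
  · refine ⟨⟨(i, j), h⟩, -1, by simp, fun t => ?_⟩
    rw [shiVector_adjSwap_mul_of_lt hn f k hi hj h]
    split_ifs <;> ring
  · subst h
    exact absurd ⟨b - a, by linarith⟩ (not_dvd_one_of_two_le hn)
  · exact ⟨⟨(j, i), h⟩, 1, by simp, shiVector_adjSwap_mul_of_gt hn f k hi hj h⟩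

/-! ### Climbing one coordinate at a time. -/

/-- If `f ≠ g` and the coordinates of `f` are bounded by those of `g`, then left multiplication
of `f` by some `s_k` raises one coordinate by one without leaving that bound. -/
theorem exists_adjSwap_mul_le {n : ℕ} (hn : 1 ≤ n) {f g : affineSymmetricGroup n}
    (hfg : f ≠ g) (hle : shiVector f ≤ shiVector g) :
    ∃ (k : Fin n) (t₀ : PairIndex n),
      (∀ t, shiVector (adjSwap k * f) t = shiVector f t + if t = t₀ then 1 else 0) ∧
      shiVector (adjSwap k * f) ≤ shiVector g := by
  have hne : g * f⁻¹ ≠ 1 := fun e => hfg (mul_inv_eq_one.1 e).symm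
  obtain ⟨y, hy⟩ := exists_descent hn hne
  -- For `n = 1`, periodicity gives `f(y + 1) = f(y) + 1`, which excludes a descent.
  have hn2 : 2 ≤ n := by
    by_contra hlt
    obtain rfl : n = 1 := by omega
    have := (g * f⁻¹).2.1 y
    rw [Nat.cast_one] at this
    omega
  have hn' : (0 : ℤ) < n := by omega
  obtain ⟨k, m, hk⟩ : ∃ (k : Fin n) (m : ℤ), y = k + m * n := by
    obtain ⟨k, m, hk⟩ := exists_window_index hn (y + 1)
    exact ⟨k, m, by linarith⟩
  have hdesc : (g * f⁻¹).1 ((k : ℤ) + 1) < (g * f⁻¹).1 k := by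
    rw [hk, add_right_comm, periodic_add_mul (g * f⁻¹).2.1, periodic_add_mul (g * f⁻¹).2.1] at hy
    linarith
  obtain ⟨i, a, hi, hi'⟩ := exists_window_eq hn f (k : ℤ)
  obtain ⟨j, b, hj, hj'⟩ := exists_window_eq hn f ((k : ℤ) + 1)
  -- This is the descent, read at the places where `f` takes the values `k` and `k + 1`. If `i < j`,
  -- it would put a coordinate of `g` strictly below that of `f`.
  have hg : window g j + b * n < window g i + a * n := by
    rw [← apply_index, ← apply_index, ← hi', ← hj']
    exact hdesc
  rcases lt_trichotomy i j with h | h | h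
  · exfalso
    have h1 : shiVector f ⟨(i, j), h⟩ = a - b := by
      simp only [shiVector, shiCoord, hi, hj]
      exact mul_add_ediv_of_lt (r := 1) (by omega) (by omega) (by ring)
    have h2 : shiVector g ⟨(i, j), h⟩ < a - b := by
      simp only [shiVector, shiCoord]
      rw [Int.ediv_lt_iff_lt_mul hn']
      linarith
    exact absurd (h1 ▸ hle ⟨(i, j), h⟩) (not_le.2 h2)
  · subst h
    exact absurd ⟨b - a, by linarith⟩ (not_dvd_one_of_two_le hn2)
  · have h1 : shiVector f ⟨(j, i), h⟩ = b - a - 1 := by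
      simp only [shiVector, shiCoord, hi, hj]
      exact mul_add_ediv_of_lt (r := n - 1) (by omega) (by omega) (by ring)
    have h2 : b - a ≤ shiVector g ⟨(j, i), h⟩ := by
      simp only [shiVector, shiCoord]
      rw [Int.le_ediv_iff_mul_le hn']
      linarith
    have hs := shiVector_adjSwap_mul_of_gt hn2 f k hi hj h
    refine ⟨k, _, hs, fun t => ?_⟩
    rw [hs]
    split_ifs with ht
    · rw [ht, h1]; linarith
    · simpa using hle t

/-- Otherwise a climbing step would push some coordinate of `f` above the common value. -/
theorem eq_of_shiVector_eq {n : ℕ} (hn : 1 ≤ n) {f g : affineSymmetricGroup n}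
    (h : shiVector f = shiVector g) : f = g := by
  by_contra hne
  obtain ⟨k, t, h1, h2⟩ := exists_adjSwap_mul_le hn hne h.le
  have h3 := h1 t
  have h4 := h2 t
  rw [if_pos rfl] at h3
  rw [← h, h3] at h4
  linarith

theorem shiVector_one {n : ℕ} : shiVector (1 : affineSymmetricGroup n) = 0 := by
  funext t
  obtain ⟨⟨p, q⟩, h⟩ := t
  have h : (p : ℕ) < q := h
  have := q.isLt
  simp only [shiVector, shiCoord, window, Subgroup.coe_one, Equiv.Perm.one_apply, Pi.zero_apply]
  exact Int.ediv_eq_zero_of_lt (by simp; omega) (by simp; omega)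

/-! ### Coxeter length. -/

/-- The number of affine inversions, by Shi's formula. -/
def shiLength {n : ℕ} (f : affineSymmetricGroup n) : ℤ := ∑ t, |shiVector f t|

theorem shiLength_adjSwap_mul_le {n : ℕ} (k : Fin n) (f : affineSymmetricGroup n) :
    shiLength (adjSwap k * f) ≤ shiLength f + 1 := by
  by_cases hn : 2 ≤ n
  · obtain ⟨t₀, ε, hε, h⟩ := exists_shiVector_adjSwap_mul hn f k
    calc shiLength (adjSwap k * f)
        ≤ ∑ t, (|shiVector f t| + if t = t₀ then 1 else 0) := by
          refine sum_le_sum fun t _ => ?_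
          rw [h]
          refine (abs_add_le _ _).trans ?_
          split_ifs <;> simp [hε]
      _ = shiLength f + 1 := by simp [sum_add_distrib, shiLength]
  · simp [adjSwap, hn]

theorem shiLength_prod_le {n : ℕ} (w : List (Fin n)) :
    shiLength (w.map adjSwap).prod ≤ w.length := by
  induction w with
  | nil => simp [shiLength, shiVector_one]
  | cons k w ih =>
    simp only [List.map_cons, List.prod_cons, List.length_cons]
    have := shiLength_adjSwap_mul_le k (w.map adjSwap).prod
    push_cast
    omega

theorem coxeterLength_le {n : ℕ} (w : List (Fin n)) :
    coxeterLength (w.map adjSwap).prod ≤ w.length :=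
  Nat.sInf_le ⟨w, rfl, rfl⟩

theorem exists_word_of_shiVector_le {n : ℕ} (hn : 1 ≤ n) {g : affineSymmetricGroup n}
    (N : ℕ) {f : affineSymmetricGroup n} (hle : shiVector f ≤ shiVector g)
    (hN : ∑ t, (shiVector g t - shiVector f t) = N) :
    ∃ w : List (Fin n), w.length = N ∧ (w.map adjSwap).prod * f = g := by
  induction N generalizing f with
  | zero =>
    refine ⟨[], rfl, ?_⟩
    have h := (sum_eq_zero_iff_of_nonneg fun t _ => sub_nonneg.2 (hle t)).1 (by simpa using hN)
    have : f = g := eq_of_shiVector_eq hn (funext fun t => (sub_eq_zero.1 (h t (mem_univ t))).symm)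
    simpa using this
  | succ N ih =>
    have hne : f ≠ g := by
      rintro rfl
      simp at hN
      omega
    obtain ⟨k, t₀, h1, h2⟩ := exists_adjSwap_mul_le hn hne hle
    obtain ⟨w, hw, hwp⟩ := ih h2 (by
      simp only [h1, ← sub_sub]
      rw [sum_sub_distrib, hN]
      simp)
    refine ⟨w ++ [k], by simp [hw], ?_⟩
    simpa [mul_assoc] using hwp

theorem exists_word_of_nonneg {n : ℕ} (hn : 1 ≤ n) {g : affineSymmetricGroup n}
    (hg : 0 ≤ shiVector g) :
    ∃ w : List (Fin n), (w.length : ℤ) = ∑ t, shiVector g t ∧ (w.map adjSwap).prod = g := by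
  have h0 : 0 ≤ ∑ t, shiVector g t := sum_nonneg fun t _ => hg t
  obtain ⟨w, hw, hwp⟩ := exists_word_of_shiVector_le hn (∑ t, shiVector g t).toNat
    (f := 1) (g := g) (by rwa [shiVector_one]) (by simp [shiVector_one, h0])
  exact ⟨w, by rw [hw, Int.toNat_of_nonneg h0], by simpa using hwp⟩

/-- The word is required because `sInf ∅ = 0` in `ℕ`: without one, `coxeterLength` would carry no
information. -/
theorem shiLength_le_coxeterLength {n : ℕ} {f : affineSymmetricGroup n}
    (h : ∃ w : List (Fin n), (w.map adjSwap).prod = f) : shiLength f ≤ coxeterLength f := by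
  obtain ⟨w, hw⟩ := h
  obtain ⟨w', hl, rfl⟩ := Nat.sInf_mem
    (⟨w.length, w, rfl, hw⟩ :
      {m | ∃ w : List (Fin n), w.length = m ∧ (w.map adjSwap).prod = f}.Nonempty)
  have := shiLength_prod_le w'
  rwa [hl] at this

theorem coxeterLength_of_nonneg {n : ℕ} (hn : 1 ≤ n) {g : affineSymmetricGroup n}
    (hg : 0 ≤ shiVector g) : (coxeterLength g : ℤ) = ∑ t, shiVector g t := by
  obtain ⟨w, hw, hwp⟩ := exists_word_of_nonneg hn hg
  have h1 := shiLength_le_coxeterLength ⟨w, hwp⟩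
  have h2 := coxeterLength_le w
  rw [hwp] at h2
  have h3 : shiLength g = ∑ t, shiVector g t := sum_congr rfl fun t _ => abs_of_nonneg (hg t)
  omega

/-! ### The weak order as the componentwise order. -/

/-- Along the climb coordinates stay nonnegative, so length equals coordinate sum and each step is a
cover. -/
theorem le_of_shiVector_le_aux {n : ℕ} (hn : 1 ≤ n) {g : affineSymmetricGroup n} (N : ℕ)
    {f : affineSymmetricGroup n} (hf : 0 ≤ shiVector f) (hle : shiVector f ≤ shiVector g)
    (hN : ∑ t, (shiVector g t - shiVector f t) = N) : f ≤ g := by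
  induction N generalizing f with
  | zero =>
    have h := (sum_eq_zero_iff_of_nonneg fun t _ => sub_nonneg.2 (hle t)).1 (by simpa using hN)
    exact (eq_of_shiVector_eq hn
      (funext fun t => (sub_eq_zero.1 (h t (mem_univ t))).symm)).le
  | succ N ih =>
    have hne : f ≠ g := by
      rintro rfl
      simp at hN
      omega
    obtain ⟨k, t₀, h1, h2⟩ := exists_adjSwap_mul_le hn hne hle
    have hf' : 0 ≤ shiVector (adjSwap k * f) := fun t => by
      have := hf t
      rw [h1]
      split_ifs
      · exact add_nonneg this zero_le_one
      · simpa using this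
    refine le_trans (Relation.ReflTransGen.single ⟨⟨k, rfl⟩, ?_⟩ : f ≤ adjSwap k * f)
      (ih hf' h2 ?_)
    · have e1 := coxeterLength_of_nonneg hn hf
      have e2 := coxeterLength_of_nonneg hn hf'
      simp only [h1, sum_add_distrib, sum_ite_eq', mem_univ, if_true] at e2
      omega
    · simp only [h1, ← sub_sub]
      rw [sum_sub_distrib, hN]
      simp

theorem le_of_shiVector_le {n : ℕ} (hn : 1 ≤ n) {f g : affineSymmetricGroup n}
    (hf : 0 ≤ shiVector f) (hle : shiVector f ≤ shiVector g) : f ≤ g :=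
  le_of_shiVector_le_aux hn (∑ t, (shiVector g t - shiVector f t)).toNat hf hle
    (Int.toNat_of_nonneg (sum_nonneg fun t _ => sub_nonneg.2 (hle t))).symm

theorem exists_word_of_one_le {n : ℕ} {f : affineSymmetricGroup n} (h : 1 ≤ f) :
    ∃ w : List (Fin n), (w.map adjSwap).prod = f := by
  replace h : Relation.ReflTransGen LeftWeakCovers 1 f := h
  induction h with
  | refl => exact ⟨[], rfl⟩
  | tail _ hc ih =>
    obtain ⟨w, rfl⟩ := ih
    obtain ⟨⟨k, rfl⟩, -⟩ := hc
    exact ⟨k :: w, by simp⟩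

/-- Below an element with nonnegative coordinates, all coordinates are nonnegative and they are
monotone for the left weak order. -/
theorem shiVector_le_of_le {n : ℕ} (hn : 1 ≤ n) {f g : affineSymmetricGroup n} (h1 : 1 ≤ f)
    (hg : 0 ≤ shiVector g) (hfg : f ≤ g) : 0 ≤ shiVector f ∧ shiVector f ≤ shiVector g := by
  replace hfg : Relation.ReflTransGen LeftWeakCovers f g := hfg
  -- The induction descends from `g`, since nonnegativity is known only at the top.
  induction hfg using Relation.ReflTransGen.head_induction_on with
  | refl => exact ⟨hg, le_rfl⟩
  | head hc _ ih =>
    rename_i a c _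
    obtain ⟨h0, hle⟩ := ih (h1.trans (Relation.ReflTransGen.single hc : a ≤ c))
    obtain ⟨⟨k, rfl⟩, hl⟩ := hc
    suffices 0 ≤ shiVector a ∧ shiVector a ≤ shiVector (adjSwap k * a) from
      ⟨this.1, this.2.trans hle⟩
    by_cases hn2 : 2 ≤ n
    · obtain ⟨t₀, ε, hε, hs⟩ := exists_shiVector_adjSwap_mul hn2 a k
      have e1 := shiLength_le_coxeterLength (exists_word_of_one_le h1)
      have e2 := coxeterLength_of_nonneg hn h0
      have e3 : shiLength a = ∑ t, (shiVector (adjSwap k * a) t +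
          if t = t₀ then |shiVector a t₀| - shiVector (adjSwap k * a) t₀ else 0) := by
        refine sum_congr rfl fun t _ => ?_
        split_ifs with ht
        · subst ht; ring
        · have e4 := hs t
          have e5 := h0 t
          rw [if_neg ht, add_zero] at e4
          rw [e4] at e5 ⊢
          rw [abs_of_nonneg e5, add_zero]
      rw [sum_add_distrib, sum_ite_eq', if_pos (mem_univ _)] at e3
      -- The length of `a` is one less than the coordinate sum of `adjSwap k * a`, and it bounds the
      -- sum of absolute values for `a`. All terms but the one at `t₀` cancel, which rules out `ε =
      -- -1` and a negative coordinate.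
      have e4 : |shiVector a t₀| + 1 ≤ shiVector (adjSwap k * a) t₀ := by omega
      have e5 := hs t₀
      rw [if_pos rfl] at e5
      have key : 0 ≤ shiVector a t₀ ∧ 0 ≤ ε := by
        rcases (abs_eq zero_le_one).1 hε with rfl | rfl
        · rcases abs_cases (shiVector a t₀) with h | h <;> omega
        · rcases abs_cases (shiVector a t₀) with h | h <;> omega
      constructor
      · intro t
        by_cases ht : t = t₀
        · rw [ht]; exact key.1
        · have := h0 t
          rwa [hs, if_neg ht, add_zero] at this
      · intro t
        rw [hs]
        split_ifs
        · linarith [key.2]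
        · simp
    · have : adjSwap k * a = a := by simp [adjSwap, hn2]
      rw [this] at h0 ⊢
      exact ⟨h0, le_rfl⟩

/-! ### From admitted vectors to affine permutations. -/

theorem sum_Icc_eq_sum_window {n : ℕ} (f : ℤ → ℤ) :
    ∑ x ∈ Icc (1 : ℤ) n, f x = ∑ i : Fin n, f ((i : ℤ) + 1) := by
  symm
  refine sum_bij (fun i _ => (i : ℤ) + 1) ?_ ?_ ?_ fun _ _ => rfl
  · intro i _
    have := i.isLt
    simp only [mem_Icc]
    omega
  · intro i _ j _ h
    exact Fin.ext (by omega)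
  · intro x hx
    rw [mem_Icc] at hx
    exact ⟨⟨(x - 1).toNat, by omega⟩, mem_univ _, by simp only; omega⟩

/-- A vector of integers that are pairwise incongruent modulo `n` and have sum `n(n+1)/2` is the
window of an affine permutation. -/
theorem exists_window {n : ℕ} (hn : 1 ≤ n) (a : Fin n → ℤ)
    (hinj : ∀ p q, (n : ℤ) ∣ a p - a q → p = q)
    (hsum : ∑ i, a i = (n : ℤ) * (n + 1) / 2) : ∃ f : affineSymmetricGroup n, window f = a := by
  have hn' : (n : ℤ) ≠ 0 := by omega
  choose idx m hx using fun x => exists_window_index hn x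
  have huniq : ∀ (i : Fin n) (k : ℤ), idx ((i : ℤ) + 1 + k * n) = i ∧
      m ((i : ℤ) + 1 + k * n) = k := by
    intro i k
    have h := hx ((i : ℤ) + 1 + k * n)
    have hi : idx ((i : ℤ) + 1 + k * n) = i :=
      eq_of_dvd_sub ⟨k - m ((i : ℤ) + 1 + k * n), by linarith⟩
    rw [hi] at h
    exact ⟨hi, (mul_right_cancel₀ hn' (by linarith : k * (n : ℤ) = _ * n)).symm⟩
  set F : ℤ → ℤ := fun x => a (idx x) + m x * n with hF
  have hFval : ∀ (i : Fin n) (k : ℤ), F ((i : ℤ) + 1 + k * n) = a i + k * n := by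
    intro i k
    simp only [hF, huniq]
  have hFinj : Function.Injective F := by
    intro x y hxy
    simp only [hF] at hxy
    have h : idx x = idx y := hinj _ _ ⟨m y - m x, by linarith⟩
    rw [h] at hxy
    rw [hx x, hx y, h, mul_right_cancel₀ hn' (by linarith : m x * (n : ℤ) = m y * n)]
  have hFsurj : Function.Surjective F := by
    intro y
    -- By pigeonhole, `n` pairwise incongruent values meet every residue class.
    have hri : Function.Injective fun p => idx (a p) := by
      intro p q hpq
      have hpq : idx (a p) = idx (a q) := hpq
      have h1 := hx (a p)
      have h2 := hx (a q)
      rw [hpq] at h1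
      exact hinj p q ⟨m (a p) - m (a q), by linarith⟩
    obtain ⟨p, hp⟩ := (Finite.injective_iff_surjective.1 hri) (idx y)
    refine ⟨(p : ℤ) + 1 + (m y - m (a p)) * n, ?_⟩
    have h1 := hx (a p)
    have h2 := hx y
    simp only at hp
    rw [hp] at h1
    rw [hFval]
    linarith
  have hper : ∀ x, F (x + n) = F x + n := by
    intro x
    have h := hx x
    generalize idx x = i at h
    generalize m x = k at h
    rw [h, hFval, show (i : ℤ) + 1 + k * n + n = (i : ℤ) + 1 + (k + 1) * n by ring, hFval]
    ring
  have hwin : ∀ i : Fin n, F ((i : ℤ) + 1) = a i := by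
    intro i
    simpa using hFval i 0
  refine ⟨⟨Equiv.ofBijective F ⟨hFinj, hFsurj⟩, hper, ?_⟩, funext hwin⟩
  exact (sum_Icc_eq_sum_window F).trans ((sum_congr rfl fun i _ => hwin i).trans hsum)

/-- The extension of `v` to all pairs of positions, by `v_{ii} = 0` and `v_{ji} = -v_{ij} - 1`
for `i < j`. -/
def extendCoord {n : ℕ} (v : PairIndex n → ℕ) (i j : Fin n) : ℤ :=
  if h : i < j then coord v i j h else if h : j < i then -(coord v j i h : ℤ) - 1 else 0

theorem extendCoord_of_lt {n : ℕ} (v : PairIndex n → ℕ) {i j : Fin n} (h : i < j) :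
    extendCoord v i j = coord v i j h := by
  simp [extendCoord, h]

theorem extendCoord_of_gt {n : ℕ} (v : PairIndex n → ℕ) {i j : Fin n} (h : j < i) :
    extendCoord v i j = -(coord v j i h : ℤ) - 1 := by
  simp [extendCoord, h, h.not_gt]

theorem extendCoord_self {n : ℕ} (v : PairIndex n → ℕ) (i : Fin n) :
    extendCoord v i i = 0 := by
  simp [extendCoord]

/-- The extension mimics `⌊-x⌋ = -⌊x⌋ - 1` for non-integral `x`. With it, every ordering of three
distinct indices reduces to the inequalities for the sorted triple. -/
theorem extendCoord_triangle {n : ℕ} {v : PairIndex n → ℕ} (hv : IsAdmitted v)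
    (i j k : Fin n) : extendCoord v i j + extendCoord v j k ≤ extendCoord v i k ∧
      extendCoord v i k ≤ extendCoord v i j + extendCoord v j k + 1 := by
  have key := hv.2
  rcases lt_trichotomy i j with h1 | rfl | h1
  · rcases lt_trichotomy j k with h2 | rfl | h2
    · rw [extendCoord_of_lt v h1, extendCoord_of_lt v h2, extendCoord_of_lt v (h1.trans h2)]
      have := key i j k h1 h2
      omega
    · rw [extendCoord_self]; omega
    · rcases lt_trichotomy i k with h3 | rfl | h3
      · rw [extendCoord_of_lt v h1, extendCoord_of_gt v h2, extendCoord_of_lt v h3]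
        have := key i k j h3 h2
        omega
      · rw [extendCoord_of_lt v h1, extendCoord_of_gt v h2, extendCoord_self]; omega
      · rw [extendCoord_of_lt v h1, extendCoord_of_gt v h2, extendCoord_of_gt v h3]
        have := key k i j h3 h1
        omega
  · rw [extendCoord_self]; omega
  · rcases lt_trichotomy j k with h2 | rfl | h2
    · rcases lt_trichotomy i k with h3 | rfl | h3
      · rw [extendCoord_of_gt v h1, extendCoord_of_lt v h2, extendCoord_of_lt v h3]
        have := key j i k h1 h3
        omega
      · rw [extendCoord_of_gt v h1, extendCoord_of_lt v h2, extendCoord_self]; omega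
      · rw [extendCoord_of_gt v h1, extendCoord_of_lt v h2, extendCoord_of_gt v h3]
        have := key j k i h2 h3
        omega
    · rw [extendCoord_self]; omega
    · rw [extendCoord_of_gt v h1, extendCoord_of_gt v h2, extendCoord_of_gt v (h2.trans h1)]
      have := key k j i h2 h1
      omega

theorem extendCoord_add_swap {n : ℕ} (v : PairIndex n → ℕ) (i j : Fin n) :
    extendCoord v i j + extendCoord v j i = if i = j then 0 else -1 := by
  rcases lt_trichotomy i j with h | rfl | h
  · rw [extendCoord_of_lt v h, extendCoord_of_gt v h, if_neg h.ne]; ring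
  · simp [extendCoord_self]
  · rw [extendCoord_of_gt v h, extendCoord_of_lt v h, if_neg h.ne']; ring

theorem sum_subtype_eq_sum_dite {ι : Type*} [Fintype ι] (P : ι → Prop) [DecidablePred P]
    (g : ∀ p, P p → ℤ) : ∑ p : {p // P p}, g p.1 p.2 = ∑ p, if h : P p then g p h else 0 := by
  rw [sum_dite, sum_const_zero, add_zero]
  refine sum_bij (fun p _ => ⟨p.1, by simpa using p.2⟩) ?_ ?_ ?_ ?_
  · simp
  · rintro ⟨p, _⟩ _ ⟨q, _⟩ _ h
    simpa using h
  · rintro ⟨p, hp⟩ _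
    exact ⟨⟨p, by simpa using hp⟩, mem_univ _, rfl⟩
  · simp

/-- Each `p > i` contributes an extra -1 to the sum; these corrections turn the term `i + 1` into
`n`, independent of `i`. -/
theorem windowMap_eq {n : ℕ} (v : PairIndex n → ℕ) (i : Fin n) :
    windowMap v i = n + ∑ p, extendCoord v p i := by
  have h1 : ∑ p : {p : Fin n // p < i}, (coord v p.1 i p.2 : ℤ) =
      ∑ p, if h : p < i then (coord v p i h : ℤ) else 0 :=
    sum_subtype_eq_sum_dite _ fun p h => (coord v p i h : ℤ)
  have h2 : ∑ p : {p : Fin n // i < p}, (coord v i p.1 p.2 : ℤ) =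
      ∑ p, if h : i < p then (coord v i p h : ℤ) else 0 :=
    sum_subtype_eq_sum_dite _ fun p h => (coord v i p h : ℤ)
  have h3 : ∑ p : Fin n, (if i < p then (1 : ℤ) else 0) = n - 1 - i := by
    have := i.isLt
    rw [sum_boole, filter_lt_eq_Ioi, Fin.card_Ioi]
    omega
  have h4 : ∀ p, extendCoord v p i = (if h : p < i then (coord v p i h : ℤ) else 0) -
      (if h : i < p then (coord v i p h : ℤ) else 0) - (if i < p then (1 : ℤ) else 0) := by
    intro p
    rcases lt_trichotomy p i with h | rfl | h
    · simp [extendCoord, h, h.not_gt]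
    · simp [extendCoord]
    · simp [extendCoord, h, h.not_gt]
  rw [windowMap, h1, h2, sum_congr rfl fun p _ => h4 p, sum_sub_distrib, sum_sub_distrib, h3]
  ring

theorem sum_windowMap {n : ℕ} (v : PairIndex n → ℕ) :
    ∑ i, windowMap v i = (n : ℤ) * (n + 1) / 2 := by
  have h1 : ∑ i, ∑ p, extendCoord v p i + ∑ i, ∑ p, extendCoord v p i = -(n : ℤ) * (n - 1) := by
    nth_rewrite 2 [sum_comm]
    simp_rw [← sum_add_distrib, extendCoord_add_swap]
    have h : ∀ i p : Fin n, (if p = i then (0 : ℤ) else -1) = (if p = i then 1 else 0) - 1 := by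
      intro i p
      split_ifs <;> rfl
    simp_rw [h, sum_sub_distrib]
    simp
    ring
  simp_rw [windowMap_eq, sum_add_distrib]
  symm
  apply Int.ediv_eq_of_eq_mul_right two_ne_zero
  simp only [sum_const, card_univ, Fintype.card_fin, nsmul_eq_mul]
  linarith

/-- The window difference minus `n` times the coordinate is a sum of `n` triangle defects `e p`,
each 0 or 1. Since `e i = 0` and `e j = 1`, it lies strictly between 0 and `n`: this gives both
incongruence and the floor. -/
theorem windowMap_sub_bounds {n : ℕ} {v : PairIndex n → ℕ} (hv : IsAdmitted v) {i j : Fin n}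
    (hij : i ≠ j) : extendCoord v i j * n + 1 ≤ windowMap v j - windowMap v i ∧
      windowMap v j - windowMap v i ≤ extendCoord v i j * n + (n - 1) := by
  set e : Fin n → ℤ := fun p => extendCoord v p j - extendCoord v p i - extendCoord v i j with he
  have h0 : ∀ p, 0 ≤ e p := fun p => by
    have := extendCoord_triangle hv p i j
    simp only [he]; linarith
  have h1 : ∀ p, 0 ≤ 1 - e p := fun p => by
    have := extendCoord_triangle hv p i j
    simp only [he]; linarith
  have hi : e i = 0 := by simp [he, extendCoord_self]
  have hj : e j = 1 := by
    have := extendCoord_add_swap v i j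
    rw [if_neg hij] at this
    simp only [he, extendCoord_self]
    linarith
  have hsum : windowMap v j - windowMap v i = extendCoord v i j * n + ∑ p, e p := by
    simp only [he, sum_sub_distrib, windowMap_eq, sum_const, card_univ, Fintype.card_fin,
      nsmul_eq_mul]
    ring
  have hlow := single_le_sum (fun p _ => h0 p) (mem_univ j)
  have hup := single_le_sum (fun p _ => h1 p) (mem_univ i)
  simp only [sum_sub_distrib, sum_const, card_univ, Fintype.card_fin, nsmul_eq_mul, mul_one] at hup
  constructor <;> linarith

theorem exists_of_isAdmitted {n : ℕ} (hn : 1 ≤ n) {v : PairIndex n → ℕ} (hv : IsAdmitted v) :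
    ∃ f : affineSymmetricGroup n, window f = windowMap v ∧ ∀ t, shiVector f t = v t := by
  have hn' : (0 : ℤ) < n := by omega
  obtain ⟨f, hf⟩ := exists_window hn (windowMap v) (fun p q h => by
    by_contra hne
    obtain ⟨h1, h2⟩ := windowMap_sub_bounds hv (Ne.symm hne)
    obtain ⟨m, hm⟩ := h
    rw [hm] at h1 h2
    have h3 : extendCoord v q p < m := by
      by_contra hc
      nlinarith [not_lt.1 hc]
    have h4 : m < extendCoord v q p + 1 := by
      by_contra hc
      nlinarith [not_lt.1 hc]
    omega) (sum_windowMap v)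
  refine ⟨f, hf, ?_⟩
  rintro ⟨⟨p, q⟩, h⟩
  have h : p < q := h
  obtain ⟨h1, h2⟩ := windowMap_sub_bounds hv h.ne
  have h3 : extendCoord v p q = v ⟨(p, q), h⟩ := extendCoord_of_lt v h
  simp only [shiVector, shiCoord, hf]
  rw [← h3, Int.ediv_eq_iff_of_pos hn']
  constructor <;> linarith

/-- Splitting off the last adjacent pair, whose coordinate is 0, costs at most 1. -/
theorem coord_le_of_isAdmitted {n : ℕ} {v : PairIndex n → ℕ} (hv : IsAdmitted v) {i j : Fin n}
    (h : i < j) : coord v i j h + (i + 1) ≤ (j : ℕ) := by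
  obtain ⟨d, hd⟩ := Nat.exists_eq_add_of_lt (show (i : ℕ) < j from h)
  induction d generalizing j with
  | zero => rw [hv.1 i j h (by omega)]; omega
  | succ d ih =>
    have hlt : i < (⟨i + d + 1, by omega⟩ : Fin n) := Fin.lt_def.2 (by simp only; omega)
    have hlt' : (⟨i + d + 1, by omega⟩ : Fin n) < j := Fin.lt_def.2 (by simp only; omega)
    have h1 := ih hlt rfl
    have h2 := hv.1 _ _ hlt' (by simp only; omega)
    have h3 := (hv.2 i _ j hlt hlt').2
    simp only at h1
    omega

/-! ### From affine permutations to admitted vectors, and the top element. -/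

theorem shiCoord_triangle {n : ℕ} (hn : 1 ≤ n) (f : affineSymmetricGroup n) (i j k : Fin n) :
    shiCoord f i j + shiCoord f j k ≤ shiCoord f i k ∧
      shiCoord f i k ≤ shiCoord f i j + shiCoord f j k + 1 := by
  have hn' : (0 : ℤ) < n := by omega
  unfold shiCoord
  have a1 := Int.emod_add_mul_ediv (window f j - window f i) n
  have a2 := Int.emod_nonneg (window f j - window f i) hn'.ne'
  have a3 := Int.emod_lt_of_pos (window f j - window f i) hn'
  have b1 := Int.emod_add_mul_ediv (window f k - window f j) n
  have b2 := Int.emod_nonneg (window f k - window f j) hn'.ne'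
  have b3 := Int.emod_lt_of_pos (window f k - window f j) hn'
  constructor
  · rw [Int.le_ediv_iff_mul_le hn']
    linarith
  · rw [← Int.lt_add_one_iff, Int.ediv_lt_iff_lt_mul hn']
    linarith

theorem exists_admittedVector {n : ℕ} (hn : 1 ≤ n) {f : affineSymmetricGroup n}
    (h0 : 0 ≤ shiVector f) (h1 : ∀ t, shiVector f t ≤ (t.1.2 : ℤ) - t.1.1 - 1) :
    ∃ v : AdmittedVector n, ∀ t, shiVector f t = v.1 t := by
  have hcast : ∀ t, ((shiVector f t).toNat : ℤ) = shiVector f t := fun t =>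
    Int.toNat_of_nonneg (h0 t)
  refine ⟨⟨fun t => (shiVector f t).toNat, ?_, ?_⟩, fun t => (hcast t).symm⟩
  · intro i j h hij
    have := h1 ⟨(i, j), h⟩
    simp only [coord]
    simp only [hij] at this
    push_cast at this
    omega
  · intro i j k hij hjk
    have e1 := hcast ⟨(i, j), hij⟩
    have e2 := hcast ⟨(j, k), hjk⟩
    have e3 := hcast ⟨(i, k), hij.trans hjk⟩
    have e4 : shiVector f ⟨(i, j), hij⟩ + shiVector f ⟨(j, k), hjk⟩ ≤
      shiVector f ⟨(i, k), hij.trans hjk⟩ ∧ shiVector f ⟨(i, k), hij.trans hjk⟩ ≤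
      shiVector f ⟨(i, j), hij⟩ + shiVector f ⟨(j, k), hjk⟩ + 1 := shiCoord_triangle hn f i j k
    simp only [coord]
    omega

theorem cSeq_eq (n i : ℕ) : cSeq n i = -((n : ℤ) * ((n : ℤ) - 3) / 2) + i * ((n : ℤ) - 1) := by
  induction i with
  | zero => simp [cSeq]
  | succ i ih => rw [cSeq, ih]; push_cast; ring

theorem sum_cSeq (n : ℕ) : ∑ i : Fin n, cSeq n i = (n : ℤ) * (n + 1) / 2 := by
  have h1 : ∀ m : ℕ, 2 * ∑ i ∈ range m, (i : ℤ) = m * (m - 1) := by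
    intro m
    induction m with
    | zero => simp
    | succ m ih => rw [sum_range_succ, mul_add, ih]; push_cast; ring
  have h2 : 2 * ((n : ℤ) * (n - 3) / 2) = n * (n - 3) := by
    apply Int.mul_ediv_cancel'
    have := (Int.even_mul_succ_self ((n : ℤ) - 3)).two_dvd
    have h := dvd_add this (Dvd.intro (n - 3 : ℤ) rfl : (2 : ℤ) ∣ 2 * (n - 3))
    rwa [show ((n : ℤ) - 3) * (n - 3 + 1) + 2 * (n - 3) = n * (n - 3) by ring] at h
  simp_rw [cSeq_eq, sum_add_distrib, ← sum_mul, Fin.sum_univ_eq_sum_range (fun i => (i : ℤ))]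
  symm
  apply Int.ediv_eq_of_eq_mul_right two_ne_zero
  simp only [sum_const, card_univ, Fintype.card_fin, nsmul_eq_mul]
  linear_combination (n : ℤ) * h2 - ((n : ℤ) - 1) * h1 n

theorem exists_window_cSeq {n : ℕ} (hn : 1 ≤ n) : ∃ f : affineSymmetricGroup n,
    (∀ i, window f i = cSeq n i) ∧ ∀ t, shiVector f t = (t.1.2 : ℤ) - t.1.1 - 1 := by
  have hn' : (0 : ℤ) < n := by omega
  obtain ⟨f, hf⟩ := exists_window hn (fun i : Fin n => cSeq n i) (fun p q h => by
    simp only [cSeq_eq] at h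
    apply eq_of_dvd_sub
    -- Modulo `n`, `c_p - c_q = (p - q)(n - 1)` is `-(p - q)`.
    have h' := dvd_sub (Dvd.intro_left ((p : ℤ) - q) rfl : (n : ℤ) ∣ ((p : ℤ) - q) * n) h
    ring_nf at h' ⊢
    exact h') (sum_cSeq n)
  refine ⟨f, fun i => congrFun hf i, ?_⟩
  rintro ⟨⟨p, q⟩, h⟩
  have h : (p : ℕ) < q := h
  have := q.isLt
  simp only [shiVector, shiCoord, hf, cSeq_eq]
  -- `(q - p)(n - 1) = (q - p - 1)n + (n - (q - p))`.
  exact mul_add_ediv_of_lt (r := n - ((q : ℤ) - p)) (by omega) (by omega) (by ring)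

/-! ### The isomorphism and the rank function. -/

theorem theorem5p1 (n : ℕ) (hn : 1 ≤ n) :
    ∃ fc : affineSymmetricGroup n, (∀ i : Fin n, window fc i = cSeq n i) ∧
      ∃ Φ : AdmittedVector n ≃o Set.Icc (1 : affineSymmetricGroup n) fc,
        (∀ v : AdmittedVector n, window (Φ v).1 = windowMap v.1) ∧
        IsRankFunction (fun v : AdmittedVector n => coxeterLength (Φ v).1) ∧
        ∀ v : AdmittedVector n, coxeterLength (Φ v).1 = ∑ t : PairIndex n, v.1 t := by
  obtain ⟨fc, hfc, hc⟩ := exists_window_cSeq hn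
  choose F hFw hFs using fun v : AdmittedVector n => exists_of_isAdmitted hn v.2
  have hF0 : ∀ v, 0 ≤ shiVector (F v) := fun v t => by simp [hFs]
  have hFle : ∀ v w, v ≤ w ↔ shiVector (F v) ≤ shiVector (F w) := by
    intro v w
    refine forall_congr' fun t => ?_
    simp [hFs]
  have hFc : ∀ v, shiVector (F v) ≤ shiVector fc := by
    rintro v ⟨⟨p, q⟩, h⟩
    have h1 : v.1 ⟨(p, q), h⟩ + (p + 1) ≤ (q : ℕ) := coord_le_of_isAdmitted v.2 h
    rw [hFs, hc]
    simp only
    omega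
  have hc0 : 0 ≤ shiVector fc := by
    rintro ⟨⟨p, q⟩, h⟩
    have h : (p : ℕ) < q := h
    rw [hc]
    simp only [Pi.zero_apply]
    omega
  have h1F : ∀ v, 1 ≤ F v := fun v =>
    le_of_shiVector_le hn shiVector_one.ge (by rw [shiVector_one]; exact hF0 v)
  let E : AdmittedVector n ↪o Set.Icc (1 : affineSymmetricGroup n) fc :=
    OrderEmbedding.ofMapLEIff (fun v => ⟨F v, h1F v, le_of_shiVector_le hn (hF0 v) (hFc v)⟩)
      fun v w => by
        rw [hFle]
        exact ⟨fun h => (shiVector_le_of_le hn (h1F v) (hF0 w) h).2,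
          fun h => le_of_shiVector_le hn (hF0 v) h⟩
  have hsurj : Function.Surjective E := by
    rintro ⟨f, h1, h2⟩
    obtain ⟨h3, h4⟩ := shiVector_le_of_le hn h1 hc0 h2
    obtain ⟨v, hv⟩ := exists_admittedVector hn h3 fun t => (h4 t).trans_eq (hc t)
    refine ⟨v, Subtype.ext (eq_of_shiVector_eq hn (funext fun t => ?_))⟩
    exact (hFs v t).trans (hv t).symm
  have hlen : ∀ v, coxeterLength (F v) = ∑ t, v.1 t := by
    intro v
    have := coxeterLength_of_nonneg hn (hF0 v)
    simp only [hFs] at this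
    exact_mod_cast this
  refine ⟨fc, hfc, RelIso.ofSurjective E hsurj, hFw, ⟨fun v hv => ?_, fun v w hvw => ?_⟩, hlen⟩
  · have h0 : IsAdmitted (0 : PairIndex n → ℕ) := ⟨fun _ _ _ _ => rfl, fun _ _ _ _ _ => by
      simp [coord]⟩
    have h1 : v ≤ ⟨0, h0⟩ := hv (fun t => Nat.zero_le _ : (⟨0, h0⟩ : AdmittedVector n) ≤ v)
    refine (hlen v).trans (sum_eq_zero fun t _ => Nat.le_zero.1 (h1 t))
  · have hne : F v ≠ F w := by
      intro h
      refine hvw.1.ne (Subtype.ext (funext fun t => ?_))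
      have := hFs v t
      rw [h, hFs w t] at this
      exact_mod_cast this.symm
    -- A climbing step from `F v` towards `F w` stays below `fc`, so it comes from an admitted `u`
    -- with `v < u ≤ w` and coordinate sum one larger. The cover forces `u = w`.
    obtain ⟨k, t₀, h1, h2⟩ := exists_adjSwap_mul_le hn hne ((hFle v w).1 hvw.1.le)
    have hge : shiVector (F v) ≤ shiVector (adjSwap k * F v) := fun t => by
      rw [h1]
      split_ifs <;> simp
    obtain ⟨u, hu⟩ := exists_admittedVector hn ((hF0 v).trans hge) fun t =>
      ((h2.trans (hFc w)) t).trans_eq (hc t)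
    have hsum : ∑ t, u.1 t = ∑ t, v.1 t + 1 := by
      have : ∑ t, (u.1 t : ℤ) = ∑ t, (v.1 t : ℤ) + 1 := by
        simp_rw [← hu, h1, hFs, sum_add_distrib]
        simp
      exact_mod_cast this
    have hvu : v < u := by
      refine lt_of_le_of_ne (fun t => ?_) ?_
      · have := hge t
        rw [hFs, hu] at this
        exact Int.ofNat_le.1 this
      · rintro rfl
        omega
    have huw : u ≤ w := fun t => by
      have := h2 t
      rw [hFs, hu] at this
      exact Int.ofNat_le.1 this
    have : u = w := huw.eq_of_not_lt (hvw.2 hvu)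
    subst this
    exact (hlen u).trans (hsum.trans (congrArg (· + 1) (hlen v).symm))
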